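/- Let $\mathbf{Rel}$ be the category of sets and relations, with dagger the converse relation. The category $\mathrm{CPM}[\mathbf{Rel}]$ has sets as objects. A morphism $A\to B$ is a completely positive relation $R\subseteq (A\times A)\times(B\times B)$: for some set $C$ and some relation $g\subseteq A\times(C\times B)$, $$(a,a')\,R\,(b,b')\iff \exists c\in C:\ a\,g\,(c,b)\ \text{and}\ a'\,g\,(c,b');$$ equivalently, $(a,a')\,R\,(b,b')$ implies $(a',a)\,R\,(b',b)$ and $(a,a)\,R\,(b,b)$. Composition, identities and dagger are those of relations. A dagger idempotent $(A,\sim)$ of $\mathrm{CPM}[\mathbf{Rel}]$ is a set $A$ with an endomorphism $\sim$ of $A$ in $\mathrm{CPM}[\mathbf{Rel}]$ such that ${\sim}^\dagger={\sim}={\sim}\circ{\sim}$; thus $\sim$ is a partial equivalence relation on $A\times A$. It is unital if $\sim$ maps the diagonal of $A\times A$ onto itself. The category $\mathrm{Split}^\dagger[\mathrm{CPM}[\mathbf{Rel}]]$ has all dagger idempotents as objects; morphisms $(A,\sim)\to(B,\approx)$ are the morphisms $R\colon A\to B$ of $\mathrm{CPM}[\mathbf{Rel}]$ with $R={\approx}\circ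 R\circ{\sim}$, and the identity of $(A,\sim)$ is $\sim$. Let $\mathrm{Split}_{\mathcal I}[\mathrm{CPM}[\mathbf{Rel}]]$ be its full subcategory on the unital dagger idempotents. The category $\mathrm{CP}^*[\mathbf{Rel}]$ has small groupoids as objects; morphisms $\mathbf G\to\mathbf H$ are the relations $R\subseteq\mathrm{Mor}(\mathbf G)\times\mathrm{Mor}(\mathbf H)$ such that $g\,R\,h$ implies $g^{-1}\,R\,h^{-1}$ and $\mathrm{id}_{\mathrm{dom}(g)}\,R\,\mathrm{id}_{\mathrm{dom}(h)}$. The canonical functor $F\colon\mathrm{CP}^*[\mathbf{Rel}]\to\mathrm{Split}_{\mathcal I}[\mathrm{CPM}[\mathbf{Rel}]]$ is given by $F(\mathbf G)=(\mathrm{Mor}(\mathbf G),\sim)$, where $(a,b)\sim(c,d)$ if and only if $a^{-1}b$ and $c^{-1}d$ are both defined and equal, and, for $R\colon\mathbf G\to\mathbf H$, by letting $F(R)$ relate $(a,b)$ to $(c,d)$ if and only if $a^{-1}b$ and $c^{-1}d$ are both defined and $(a^{-1}b)\,R\,(c^{-1}d)$. **Theorem.** 1. The functor $F\colon\mathrm{CP}^*[\mathbf{Rel}]\to\mathrm{Split}_{\mathcal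 I}[\mathrm{CPM}[\mathbf{Rel}]]$ is not an equivalence of categories. 2. More precisely, let $X=\{0,1,2\}$ and let $\sim$ be the partial equivalence relation on $X\times X$ in which each of the seven pairs $(0,0),(1,1),(2,2),(0,1),(1,0),(1,2),(2,1)$ is related to itself and nothing else is related (so $(0,2)\not\sim(0,2)$ and $(2,0)\not\sim(2,0)$). Then $(X,\sim)$ is an object of $\mathrm{Split}_{\mathcal I}[\mathrm{CPM}[\mathbf{Rel}]]$ that is not isomorphic to $F(\mathbf G)$ for any small groupoid $\mathbf G$. 3. For a dagger idempotent $(A,\sim)$ of $\mathrm{CPM}[\mathbf{Rel}]$ write $\mathrm{Dom}(\sim)=\{z\in A\times A: z\sim z\}$, and $[a,a']$ for the class of $(a,a')$ in $\mathrm{Dom}(\sim)/{\sim}$. Two objects $(A,\sim)$ and $(B,\approx)$ of $\mathrm{Split}^\dagger[\mathrm{CPM}[\mathbf{Rel}]]$ are isomorphic if and only if there is a bijection $\alpha\colon\mathrm{Dom}(\sim)/{\sim}\to\mathrm{Dom}(\approx)/{\approx}$ such that, for all $(a,a')\in\mathrm{Dom}(\sim)$ and $(b,b')\in\mathrm{Dom}(\approx)$,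 $$\alpha([a,a'])=[b,b']\ \Longrightarrow\ \alpha([a',a])=[b',b]\ \text{ and }\ \alpha([a,a])=[b,b].$$ -/

import Mathlib

open CategoryTheory CategoryTheory.Idempotents

universe v u

/-! ### Dagger categories and dagger idempotents -/

/-- A dagger category: an identity-on-objects, involutive, contravariant operation on morphisms. -/
class DaggerCategory (C : Type u) extends Category.{v} C where
  dag : ∀ {X Y : C}, (X ⟶ Y) → (Y ⟶ X)
  dag_id : ∀ X : C, dag (𝟙 X) = 𝟙 X
  dag_comp : ∀ {X Y Z : C} (f : X ⟶ Y) (g : Y ⟶ Z), dag (f ≫ g) = dag g ≫ dag f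
  dag_dag : ∀ {X Y : C} (f : X ⟶ Y), dag (dag f) = f

/-- The pairs `(X, p)` with `p ≫ p = p` and `p† = p`.  The category `Karoubi C` has the idempotents
of `C` as objects, and the morphisms `f` with `p ≫ f ≫ q = f` as morphisms `(X, p) ⟶ (Y, q)`. -/
def IsDaggerIdempotent (C : Type u) [DaggerCategory.{v} C] : ObjectProperty (Karoubi C) :=
  fun P => DaggerCategory.dag P.p = P.p

/-- The category `Split†[C]` that splits all dagger idempotents of `C`. -/
abbrev SplitDagger (C : Type u) [DaggerCategory.{v} C] := (IsDaggerIdempotent C).FullSubcategory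

/-! ### The category `CPM[Rel]` -/

/-- A relation `A × A → B × B` is completely positive when it is `g_* ⊗ g` with the ancillary
system `C` contracted, for some set `C` and some relation `g : A → C × B`.  In the category of
sets and relations every object is its own dual, and `g_* = g`. -/
def IsCP {A B : Type u} (R : SetRel (A × A) (B × B)) : Prop :=
  ∃ (C : Type u) (g : SetRel A (C × B)), ∀ (a a' : A) (b b' : B),
    ((a, a'), (b, b')) ∈ R ↔ ∃ c : C, (a, (c, b)) ∈ g ∧ (a', (c, b')) ∈ g

/-- Complete positivity of relations in elementary terms. -/
theorem isCP_iff {A B : Type u} (R : SetRel (A × A) (B × B)) :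
    IsCP R ↔ ∀ (a a' : A) (b b' : B), ((a, a'), (b, b')) ∈ R →
      ((a', a), (b', b)) ∈ R ∧ ((a, a), (b, b)) ∈ R := by
  constructor
  · rintro ⟨C, g, hg⟩ a a' b b' h
    obtain ⟨c, h1, h2⟩ := (hg _ _ _ _).1 h
    exact ⟨(hg _ _ _ _).2 ⟨c, h2, h1⟩, (hg _ _ _ _).2 ⟨c, h1, h1⟩⟩
  · intro H
    refine ⟨{t : (A × A) × (B × B) // t ∈ R},
      {t | (t.1 = t.2.1.1.1.1 ∧ t.2.2 = t.2.1.1.2.1) ∨ (t.1 = t.2.1.1.1.2 ∧ t.2.2 = t.2.1.1.2.2)},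
      fun a a' b b' => ⟨fun h => ⟨⟨_, h⟩, Or.inl ⟨rfl, rfl⟩, Or.inr ⟨rfl, rfl⟩⟩, ?_⟩⟩
    rintro ⟨⟨⟨⟨x, x'⟩, ⟨y, y'⟩⟩, hc⟩, h1, h2⟩
    have hs := (H _ _ _ _ hc).1
    rcases h1 with ⟨h1, h1'⟩ | ⟨h1, h1'⟩ <;> rcases h2 with ⟨h2, h2'⟩ | ⟨h2, h2'⟩ <;>
      (dsimp only at h1 h1' h2 h2'; subst h1 h1' h2 h2')
    · exact (H _ _ _ _ hc).2
    · exact hc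
    · exact hs
    · exact (H _ _ _ _ hs).2

/-- The objects of `CPM[Rel]` are sets. -/
structure CPMRel : Type (u + 1) where
  carrier : Type u

/-- A morphism `A ⟶ B` of `CPM[Rel]` is a completely positive relation `A × A → B × B`. -/
@[ext]
structure CPMRel.Hom (A B : CPMRel.{u}) : Type u where
  rel : SetRel (A.carrier × A.carrier) (B.carrier × B.carrier)
  cp : IsCP rel

/-- Composition, identities and dagger are those of relations. -/
instance : DaggerCategory.{u} CPMRel.{u} where
  Hom := CPMRel.Hom
  id A := ⟨SetRel.id, (isCP_iff _).2 fun a a' b b' h => by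
    simp only [SetRel.mem_id, Prod.mk.injEq] at h ⊢
    exact ⟨⟨h.2, h.1⟩, h.1, h.1⟩⟩
  comp R S := ⟨R.rel.comp S.rel, (isCP_iff _).2 (by
    rintro a a' b b' ⟨⟨x, x'⟩, h1, h2⟩
    have k1 := (isCP_iff _).1 R.cp _ _ _ _ h1
    have k2 := (isCP_iff _).1 S.cp _ _ _ _ h2
    exact ⟨⟨_, k1.1, k2.1⟩, ⟨_, k1.2, k2.2⟩⟩)⟩
  id_comp R := CPMRel.Hom.ext (SetRel.id_comp _)
  comp_id R := CPMRel.Hom.ext (SetRel.comp_id _)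
  assoc R S T := CPMRel.Hom.ext (SetRel.comp_assoc _ _ _)
  dag R := ⟨R.rel.inv, (isCP_iff _).2 fun a a' b b' h => (isCP_iff _).1 R.cp _ _ _ _ h⟩
  dag_id _ := CPMRel.Hom.ext SetRel.inv_id
  dag_comp _ _ := CPMRel.Hom.ext (SetRel.inv_comp _ _)
  dag_dag _ := rfl

/-- A completely positive relation is unital when it preserves the canonical state
`{(a, a)} : I → A × A`, i.e. when it maps the diagonal of `A` onto the diagonal of `B`. -/
def CPMRel.Hom.Unital {A B : CPMRel.{u}} (R : CPMRel.Hom A B) : Prop :=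
  R.rel.image (Set.diagonal A.carrier) = Set.diagonal B.carrier

/-- The class `I` of unital dagger idempotents of `CPM[Rel]`. -/
def IsUnitalDaggerIdempotent : ObjectProperty (Karoubi CPMRel.{u}) :=
  fun P => IsDaggerIdempotent CPMRel.{u} P ∧ CPMRel.Hom.Unital P.p

/-- The category `Split_I[CPM[Rel]]` that splits the unital dagger idempotents of `CPM[Rel]`. -/
abbrev SplitUnital := (IsUnitalDaggerIdempotent.{u}).FullSubcategory

/-! ### The category `CP*[Rel]` of groupoids and relations -/

/-- The set of all morphisms of a groupoid. -/
structure Mor (G : Type u) [Groupoid.{u} G] : Type u where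
  {dom : G}
  {cod : G}
  hom : dom ⟶ cod

namespace Mor

variable {G : Type u} [Groupoid.{u} G]

/-- The inverse of a morphism. -/
def inv (f : Mor G) : Mor G := ⟨Groupoid.inv f.hom⟩

/-- The identity on the domain. -/
def idDom (f : Mor G) : Mor G := ⟨𝟙 f.dom⟩

/-- `IsComp g f h` says that the composite `g ∘ f` is defined and equal to `h`. -/
inductive IsComp : Mor G → Mor G → Mor G → Prop
  | mk {x y z : G} (f : x ⟶ y) (g : y ⟶ z) : IsComp ⟨g⟩ ⟨f⟩ ⟨f ≫ g⟩

end Mor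

/-- The objects of `CP*[Rel]` are small groupoids. -/
structure CPStarRel : Type (u + 1) where
  grpd : Grpd.{u, u}

/-- The set of morphisms of an object of `CP*[Rel]`. -/
abbrev CPStarRel.Mor (G : CPStarRel.{u}) : Type u := _root_.Mor G.grpd

/-- The morphisms of `CP*[Rel]` are the relations `R` between the sets of morphisms such that
`g R h` implies `g⁻¹ R h⁻¹` and `id_{dom g} R id_{dom h}`. -/
@[ext]
structure CPStarRel.Hom (G H : CPStarRel.{u}) : Type u where
  rel : SetRel G.Mor H.Mor
  inv_mem : ∀ g h, (g, h) ∈ rel → (g.inv, h.inv) ∈ rel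
  idDom_mem : ∀ g h, (g, h) ∈ rel → (g.idDom, h.idDom) ∈ rel

/-- Composition and identities are those of relations. -/
instance : Category.{u} CPStarRel.{u} where
  Hom := CPStarRel.Hom
  id G := ⟨SetRel.id, by rintro g h (rfl : g = h); exact rfl,
    by rintro g h (rfl : g = h); exact rfl⟩
  comp R S := ⟨R.rel.comp S.rel,
    by rintro g h ⟨k, h1, h2⟩; exact ⟨_, R.inv_mem _ _ h1, S.inv_mem _ _ h2⟩,
    by rintro g h ⟨k, h1, h2⟩; exact ⟨_, R.idDom_mem _ _ h1, S.idDom_mem _ _ h2⟩⟩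
  id_comp R := CPStarRel.Hom.ext (SetRel.id_comp _)
  comp_id R := CPStarRel.Hom.ext (SetRel.comp_id _)
  assoc R S T := CPStarRel.Hom.ext (SetRel.comp_assoc _ _ _)

/-! ### The canonical functor -/

/-- The coaction of a groupoid: `(a, b)` is related to `a⁻¹ ∘ b` whenever this composite exists.
The action is the inverse relation. -/
def coaction (G : CPStarRel.{u}) : SetRel (G.Mor × G.Mor) G.Mor :=
  {t | Mor.IsComp t.1.1.inv t.1.2 t.2}

/-- The relation `action ∘ R ∘ coaction`: it relates `(a, b)` to `(c, d)` precisely when `a⁻¹ ∘ b`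
and `c⁻¹ ∘ d` are defined and related by `R`. -/
def conj {G H : CPStarRel.{u}} (R : SetRel G.Mor H.Mor) :
    SetRel (G.Mor × G.Mor) (H.Mor × H.Mor) :=
  ((coaction G).comp R).comp (coaction H).inv

theorem mem_coaction {G : CPStarRel.{u}} (a b e : G.Mor) :
    ((a, b), e) ∈ coaction G ↔
      ∃ (x y z : G.grpd) (f : x ⟶ z) (g : y ⟶ z),
        a = ⟨f⟩ ∧ b = ⟨g⟩ ∧ e = ⟨g ≫ Groupoid.inv f⟩ := by
  constructor
  · obtain ⟨f⟩ := a
    intro h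
    change Mor.IsComp (⟨Groupoid.inv f⟩ : Mor G.grpd) b e at h
    cases h with
    | mk g _ => exact ⟨_, _, _, f, g, rfl, rfl, rfl⟩
  · rintro ⟨x, y, z, f, g, rfl, rfl, rfl⟩
    exact Mor.IsComp.mk g (Groupoid.inv f)

theorem coaction_swap {G : CPStarRel.{u}} {a b e : G.Mor} (h : ((a, b), e) ∈ coaction G) :
    ((b, a), e.inv) ∈ coaction G := by
  obtain ⟨x, y, z, f, g, rfl, rfl, rfl⟩ := (mem_coaction _ _ _).1 h
  refine (mem_coaction _ _ _).2 ⟨_, _, _, g, f, rfl, rfl, ?_⟩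
  simp [Mor.inv]

theorem coaction_diag {G : CPStarRel.{u}} {a b e : G.Mor} (h : ((a, b), e) ∈ coaction G) :
    ((a, a), e.inv.idDom) ∈ coaction G := by
  obtain ⟨x, y, z, f, g, rfl, rfl, rfl⟩ := (mem_coaction _ _ _).1 h
  refine (mem_coaction _ _ _).2 ⟨_, _, _, f, f, rfl, rfl, ?_⟩
  simp [Mor.inv, Mor.idDom]

/-- The action is a section of the coaction. -/
theorem inv_coaction_comp_coaction (G : CPStarRel.{u}) :
    (coaction G).inv.comp (coaction G) = SetRel.id := by
  ext ⟨e, e'⟩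
  constructor
  · rintro ⟨⟨a, b⟩, h1, h2⟩
    obtain ⟨x, y, z, f, g, rfl, rfl, he⟩ := (mem_coaction _ _ _).1 h1
    obtain ⟨x', y', z', f', g', h3, h4, rfl⟩ := (mem_coaction _ _ _).1 h2
    cases h3
    cases h4
    exact he
  · rintro (rfl : e = e')
    obtain ⟨f⟩ := e
    have : ((⟨𝟙 _⟩, ⟨f⟩), ⟨f⟩) ∈ coaction G :=
      (mem_coaction _ _ _).2 ⟨_, _, _, 𝟙 _, f, rfl, rfl, by simp⟩
    exact ⟨_, this, this⟩

/-- A relation is a morphism of `CP*[Rel]` precisely when `action ∘ R ∘ coaction` is completely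
positive. -/
theorem isCP_conj_iff {G H : CPStarRel.{u}} (R : SetRel G.Mor H.Mor) :
    IsCP (conj R) ↔ ∀ g h, (g, h) ∈ R → (g.inv, h.inv) ∈ R ∧ (g.idDom, h.idDom) ∈ R := by
  rw [isCP_iff]
  constructor
  · intro H' g h hR
    have key : ∀ {a b c d e e'}, ((a, b), e) ∈ coaction G → ((c, d), e') ∈ coaction H →
        ((a, b), (c, d)) ∈ conj R → (e, e') ∈ R := by
      intro a b c d e e' h1 h2 h3
      obtain ⟨e₂, ⟨e₁, h4, h5⟩, h6⟩ := h3
      have i1 : (e, e₁) ∈ (coaction G).inv.comp (coaction G) := ⟨_, h1, h4⟩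
      have i2 : (e₂, e') ∈ (coaction H).inv.comp (coaction H) := ⟨_, h6, h2⟩
      rw [inv_coaction_comp_coaction] at i1 i2
      obtain rfl : e = e₁ := i1
      obtain rfl : e₂ = e' := i2
      exact h5
    have main : ∀ g h, (g, h) ∈ R → (g.inv, h.inv) ∈ R ∧ (g.inv.idDom, h.inv.idDom) ∈ R := by
      intro g h hR
      have hg : (g, g) ∈ (coaction G).inv.comp (coaction G) := by
        rw [inv_coaction_comp_coaction]; exact rfl
      have hh : (h, h) ∈ (coaction H).inv.comp (coaction H) := by
        rw [inv_coaction_comp_coaction]; exact rfl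
      obtain ⟨⟨a, b⟩, h1, -⟩ := hg
      obtain ⟨⟨c, d⟩, h2, -⟩ := hh
      have h3 := H' a b c d ⟨_, ⟨_, h1, hR⟩, h2⟩
      exact ⟨key (coaction_swap h1) (coaction_swap h2) h3.1,
        key (coaction_diag h1) (coaction_diag h2) h3.2⟩
    refine ⟨(main g h hR).1, ?_⟩
    have := (main _ _ (main g h hR).1).2
    simpa [Mor.inv, Mor.idDom] using this
  · rintro H' a a' b b' ⟨e', ⟨e, h1, h2⟩, h3⟩
    have h4 := (H' _ _ h2).1
    exact ⟨⟨_, ⟨_, coaction_swap h1, h4⟩, coaction_swap h3⟩,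
      ⟨_, ⟨_, coaction_diag h1, (H' _ _ h4).2⟩, coaction_diag h3⟩⟩

theorem conj_comp {G H K : CPStarRel.{u}} (R : SetRel G.Mor H.Mor) (S : SetRel H.Mor K.Mor) :
    (conj R).comp (conj S) = conj (R.comp S) := by
  unfold conj
  rw [SetRel.comp_assoc ((coaction G).comp R), ← SetRel.comp_assoc (coaction H).inv,
    ← SetRel.comp_assoc (coaction H).inv, inv_coaction_comp_coaction, SetRel.id_comp,
    SetRel.comp_assoc, SetRel.comp_assoc, SetRel.comp_assoc]

/-- The completely positive relation `action ∘ R ∘ coaction` of a morphism `R` of `CP*[Rel]`. -/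
def conjHom {G H : CPStarRel.{u}} (R : G ⟶ H) : (⟨G.Mor⟩ : CPMRel.{u}) ⟶ ⟨H.Mor⟩ :=
  CPMRel.Hom.mk (conj (CPStarRel.Hom.rel R)) ((isCP_conj_iff _).2 fun g h hR =>
    ⟨CPStarRel.Hom.inv_mem R g h hR, CPStarRel.Hom.idDom_mem R g h hR⟩)

theorem conjHom_comp {G H K : CPStarRel.{u}} (R : G ⟶ H) (S : H ⟶ K) :
    conjHom R ≫ conjHom S = conjHom (R ≫ S) :=
  CPMRel.Hom.ext (conj_comp _ _)

/-- The functor that sends a groupoid `G` to the pair `(Mor G, action ∘ coaction)`, where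
`(a, b)` and `(c, d)` are related if and only if `a⁻¹ ∘ b = c⁻¹ ∘ d` (both composites being
defined), and a morphism `R` to `action ∘ R ∘ coaction`. -/
def toKaroubiCPM : CPStarRel.{u} ⥤ Karoubi CPMRel.{u} where
  obj G := ⟨⟨G.Mor⟩, conjHom (𝟙 G), by rw [conjHom_comp, Category.id_comp]⟩
  map {G H} R := ⟨conjHom R, by
    change conjHom (𝟙 G) ≫ conjHom R ≫ conjHom (𝟙 H) = conjHom R
    rw [conjHom_comp, conjHom_comp, Category.id_comp, Category.comp_id]⟩
  map_id G := rfl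
  map_comp R S := Karoubi.hom_ext _ _ (conjHom_comp R S).symm

theorem toKaroubiCPM_isDaggerIdempotent (G : CPStarRel.{u}) :
    IsDaggerIdempotent CPMRel.{u} (toKaroubiCPM.obj G) := by
  apply CPMRel.Hom.ext
  change (((coaction G).comp SetRel.id).comp (coaction G).inv).inv =
    ((coaction G).comp SetRel.id).comp (coaction G).inv
  rw [SetRel.comp_id, SetRel.inv_comp, SetRel.inv_inv]

theorem toKaroubiCPM_isUnital (G : CPStarRel.{u}) :
    IsUnitalDaggerIdempotent (toKaroubiCPM.obj G) := by
  refine ⟨toKaroubiCPM_isDaggerIdempotent G, ?_⟩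
  change (((coaction G).comp SetRel.id).comp (coaction G).inv).image (Set.diagonal G.Mor) =
    Set.diagonal G.Mor
  rw [SetRel.comp_id]
  ext ⟨c, d⟩
  constructor
  · rintro ⟨⟨a, b⟩, hab, e, h1, h2⟩
    obtain rfl : a = b := hab
    obtain ⟨x, y, z, f, g, h3, h4, rfl⟩ := (mem_coaction _ _ _).1 h1
    obtain ⟨x', y', z', f', g', rfl, rfl, h5⟩ := (mem_coaction _ _ _).1 h2
    subst h3
    cases h4
    rw [Groupoid.comp_inv] at h5
    generalize hk : g' ≫ Groupoid.inv f' = k at h5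
    cases h5
    have : g' = f' := by
      have := congrArg (· ≫ f') hk
      simpa using this
    rw [this]
    rfl
  · intro h
    obtain rfl : c = d := h
    obtain ⟨f⟩ := c
    have : ((⟨f⟩, ⟨f⟩), ⟨f ≫ Groupoid.inv f⟩) ∈ coaction G :=
      (mem_coaction _ _ _).2 ⟨_, _, _, f, f, rfl, rfl, rfl⟩
    exact ⟨(⟨f⟩, ⟨f⟩), rfl, _, this, this⟩

/-- The canonical functor `F : CP*[Rel] ⥤ Split_I[CPM[Rel]]`. -/
def canonicalFunctor : CPStarRel.{u} ⥤ SplitUnital.{u} :=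
  ObjectProperty.lift _ toKaroubiCPM toKaroubiCPM_isUnital

/-! ### The witness -/

/-- The elements of `{0, 1, 2} × {0, 1, 2}` other than `(0, 2)` and `(2, 0)`. -/
def witnessDom : Set (Fin 3 × Fin 3) :=
  {(0, 0), (1, 1), (2, 2), (0, 1), (1, 0), (1, 2), (2, 1)}

/-- The partial equivalence relation `∼` on `X × X`, for `X` (a copy in the universe `u` of)
`{0, 1, 2}`, for which `z ∼ z` for the seven pairs `z` above, and nothing else is related. -/
def witnessRel : SetRel (ULift.{u} (Fin 3) × ULift.{u} (Fin 3))
    (ULift.{u} (Fin 3) × ULift.{u} (Fin 3)) :=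
  {t | t.1 = t.2 ∧ (t.1.1.down, t.1.2.down) ∈ witnessDom}

theorem witnessRel_isCP : IsCP witnessRel.{u} := by
  rw [isCP_iff]
  rintro ⟨a⟩ ⟨a'⟩ ⟨b⟩ ⟨b'⟩ ⟨h1, h2⟩
  obtain ⟨rfl, rfl⟩ : a = b ∧ a' = b' := by simpa using h1
  refine ⟨⟨rfl, ?_⟩, rfl, ?_⟩ <;>
  · dsimp only at h2 ⊢
    revert h2
    simp only [witnessDom, Set.mem_insert_iff, Set.mem_singleton_iff]
    revert a a'
    decide

/-- The witness, as an object of `Split_I[CPM[Rel]]`. -/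
def witness : SplitUnital.{u} where
  obj :=
    { X := ⟨ULift.{u} (Fin 3)⟩
      p := CPMRel.Hom.mk witnessRel witnessRel_isCP
      idem := CPMRel.Hom.ext (by
        change witnessRel.comp witnessRel = witnessRel
        ext ⟨z, w⟩
        constructor
        · rintro ⟨_, ⟨h1, h1'⟩, ⟨h2, h2'⟩⟩
          exact ⟨h1.trans h2, h1'⟩
        · rintro ⟨h, h'⟩
          obtain rfl : z = w := h
          exact ⟨z, ⟨rfl, h'⟩, ⟨rfl, h'⟩⟩) }
  property := by
    refine ⟨CPMRel.Hom.ext ?_, ?_⟩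
    · change witnessRel.inv = witnessRel
      ext ⟨z, w⟩
      constructor
      · rintro ⟨h, h'⟩
        obtain rfl : w = z := h
        exact ⟨rfl, h'⟩
      · rintro ⟨h, h'⟩
        obtain rfl : z = w := h
        exact ⟨rfl, h'⟩
    · change witnessRel.image (Set.diagonal _) = Set.diagonal _
      ext z
      constructor
      · rintro ⟨w, hw, h, -⟩
        obtain rfl : w = z := h
        exact hw
      · intro hz
        refine ⟨z, hz, rfl, ?_⟩
        obtain ⟨⟨a⟩, ⟨b⟩⟩ := z
        cases hz
        simp only [witnessDom, Set.mem_insert_iff, Set.mem_singleton_iff]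
        revert a
        decide

/-! ### Quotients of partial equivalence relations -/

namespace SplitDagger

variable (P : SplitDagger CPMRel.{u})

/-- The underlying set `A` of an object `(A, ∼)` of `Split†[CPM[Rel]]`. -/
abbrev Carrier : Type u := P.obj.X.carrier

/-- The partial equivalence relation `∼` on `A × A`. -/
def rel : SetRel (P.Carrier × P.Carrier) (P.Carrier × P.Carrier) := CPMRel.Hom.rel P.obj.p

/-- `Dom(∼)` is the set of those `z` with `z ∼ z`. -/
def Dom : Set (P.Carrier × P.Carrier) := {z | (z, z) ∈ P.rel}

theorem rel_symm {z w : P.Carrier × P.Carrier} (h : (z, w) ∈ P.rel) : (w, z) ∈ P.rel := by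
  have : SetRel.inv P.rel = P.rel := congrArg CPMRel.Hom.rel P.property
  rw [← this]
  exact h

theorem rel_trans {z w t : P.Carrier × P.Carrier} (h : (z, w) ∈ P.rel) (h' : (w, t) ∈ P.rel) :
    (z, t) ∈ P.rel := by
  have : SetRel.comp P.rel P.rel = P.rel := congrArg CPMRel.Hom.rel P.obj.idem
  rw [← this]
  exact ⟨w, h, h'⟩

/-- The restriction of `∼` to `Dom(∼)` is an equivalence relation. -/
def domSetoid : Setoid P.Dom where
  r z w := (z.1, w.1) ∈ P.rel
  iseqv := ⟨fun z => z.2, fun h => P.rel_symm h, fun h h' => P.rel_trans h h'⟩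

/-- The quotient `Dom(∼)/∼`. -/
def Quot : Type u := Quotient P.domSetoid

/-- The class `[a, a']` of an element of `Dom(∼)`. -/
def cls {a a' : P.Carrier} (h : (a, a') ∈ P.Dom) : P.Quot := Quotient.mk P.domSetoid ⟨(a, a'), h⟩

variable {P}

theorem dom_swap {a a' : P.Carrier} (h : (a, a') ∈ P.Dom) : (a', a) ∈ P.Dom :=
  ((isCP_iff _).1 (CPMRel.Hom.cp P.obj.p) _ _ _ _ h).1

theorem dom_diag {a a' : P.Carrier} (h : (a, a') ∈ P.Dom) : (a, a) ∈ P.Dom :=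
  ((isCP_iff _).1 (CPMRel.Hom.cp P.obj.p) _ _ _ _ h).2

end SplitDagger

namespace SplitDagger

variable {P Q : SplitDagger CPMRel.{u}}

/-! A morphism of `SplitDagger` absorbs the idempotents at both ends, so it is a relation between
the quotients `Dom(∼)/∼`, and the identity morphism becomes equality of classes. Invertible
relations are bijections; complete positivity, in the elementary form `isCP_iff`, becomes
compatibility with `[a, a'] ↦ [a', a]` and `[a, a'] ↦ [a, a]`. This is `nonempty_iso_iff`.

In `F(G)` the class `[a, b]` is the arrow `a⁻¹b : dom b → dom a`, and `[a, a]`, `[b, b]` are the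
identities at its ends. Composition in `G` gives: if `[p', p'] = [q, q]`, then some class has ends
`[p, p]` and `[q', q']` (`exists_composite`). A bijection as above preserves ends, so this property
is invariant under isomorphism. The witness violates it: `[0, 1]` and `[1, 2]` exist, but `(0, 2)`
is outside the domain. Hence the functor misses the witness up to isomorphism and is not essentially
surjective. -/

theorem cls_eq_iff {a a' b b' : P.Carrier} (h : (a, a') ∈ P.Dom) (k : (b, b') ∈ P.Dom) :
    P.cls h = P.cls k ↔ ((a, a'), (b, b')) ∈ P.rel :=
  Quotient.eq (r := P.domSetoid)

theorem exists_cls (x : P.Quot) : ∃ (a a' : P.Carrier) (h : (a, a') ∈ P.Dom), P.cls h = x := by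
  obtain ⟨⟨⟨a, a'⟩, h⟩, rfl⟩ := Quotient.exists_rep x
  exact ⟨a, a', h, rfl⟩

theorem left_mem_dom {z w : P.Carrier × P.Carrier} (h : (z, w) ∈ P.rel) : z ∈ P.Dom :=
  P.rel_trans h (P.rel_symm h)

theorem right_mem_dom {z w : P.Carrier × P.Carrier} (h : (z, w) ∈ P.rel) : w ∈ P.Dom :=
  P.rel_trans (P.rel_symm h) h

/-! ### From isomorphisms to bijections of quotients -/

/-- The completely positive relation underlying a morphism of `Split†[CPM[Rel]]`. -/
def homRel (f : P ⟶ Q) : SetRel (P.Carrier × P.Carrier) (Q.Carrier × Q.Carrier) :=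
  CPMRel.Hom.rel f.hom.f

theorem homRel_isCP (f : P ⟶ Q) : IsCP (homRel f) := CPMRel.Hom.cp f.hom.f

theorem homRel_id : homRel (𝟙 P) = P.rel := rfl

theorem homRel_comp {T : SplitDagger CPMRel.{u}} (f : P ⟶ Q) (g : Q ⟶ T) :
    homRel (f ≫ g) = (homRel f).comp (homRel g) := rfl

theorem homRel_absorb (f : P ⟶ Q) :
    P.rel.comp ((homRel f).comp Q.rel) = homRel f :=
  congrArg CPMRel.Hom.rel f.hom.comm

theorem mem_dom_of_homRel (f : P ⟶ Q) {z w} (h : (z, w) ∈ homRel f) :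
    z ∈ P.Dom ∧ w ∈ Q.Dom := by
  rw [← homRel_absorb] at h
  obtain ⟨z', hz, w', -, hw⟩ := h
  exact ⟨left_mem_dom hz, right_mem_dom hw⟩

/-- Saturation: membership depends only on the two classes, which is what lets a morphism descend to
the quotients. -/
theorem homRel_of_rel (f : P ⟶ Q) {z z' w w'} (hz : (z', z) ∈ P.rel) (h : (z, w) ∈ homRel f)
    (hw : (w, w') ∈ Q.rel) : (z', w') ∈ homRel f := by
  rw [← homRel_absorb]
  exact ⟨z, hz, w, h, hw⟩

theorem exists_homRel (i : P ≅ Q) {z} (hz : z ∈ P.Dom) :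
    ∃ w, (z, w) ∈ homRel i.hom ∧ (w, z) ∈ homRel i.inv := by
  have h : (z, z) ∈ homRel (𝟙 P) := hz
  rw [← i.hom_inv_id, homRel_comp] at h
  exact h

theorem rel_of_homRel (i : P ≅ Q) {z w w'} (h : (w, z) ∈ homRel i.inv)
    (h' : (z, w') ∈ homRel i.hom) : (w, w') ∈ Q.rel := by
  rw [← homRel_id, ← i.inv_hom_id, homRel_comp]
  exact ⟨z, h, h'⟩

/-- The inverse sends some `w₀` back to `z`; composing it with either image of `z` lands in the
identity of `Q`, so both images are equivalent to `w₀`. -/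
theorem homRel_rightUnique (i : P ≅ Q) {z w w'} (h : (z, w) ∈ homRel i.hom)
    (h' : (z, w') ∈ homRel i.hom) : (w, w') ∈ Q.rel := by
  obtain ⟨w₀, -, hw₀⟩ := exists_homRel i (mem_dom_of_homRel _ h).1
  exact Q.rel_trans (Q.rel_symm (rel_of_homRel i hw₀ h)) (rel_of_homRel i hw₀ h')

theorem homRel_inv (i : P ≅ Q) {z w} (h : (z, w) ∈ homRel i.hom) : (w, z) ∈ homRel i.inv := by
  obtain ⟨w₀, hw₀, hw₀'⟩ := exists_homRel i (mem_dom_of_homRel _ h).1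
  exact homRel_of_rel _ (homRel_rightUnique i h hw₀) hw₀' (mem_dom_of_homRel _ h).1

/-- An isomorphism of dagger idempotents induces a map of the quotients. -/
theorem exists_quot_map (i : P ≅ Q) : ∃ f : P.Quot → Q.Quot,
    ∀ (a a' : P.Carrier) (b b' : Q.Carrier) (h : (a, a') ∈ P.Dom) (k : (b, b') ∈ Q.Dom),
      f (P.cls h) = Q.cls k ↔ ((a, a'), (b, b')) ∈ homRel i.hom := by
  have key : ∀ x : P.Quot, ∃ y : Q.Quot, ∃ (a a' : P.Carrier) (b b' : Q.Carrier)
      (h : (a, a') ∈ P.Dom) (k : (b, b') ∈ Q.Dom),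
      P.cls h = x ∧ Q.cls k = y ∧ ((a, a'), (b, b')) ∈ homRel i.hom := by
    intro x
    obtain ⟨a, a', h, rfl⟩ := exists_cls x
    obtain ⟨⟨b, b'⟩, hw, -⟩ := exists_homRel i h
    exact ⟨_, a, a', b, b', h, (mem_dom_of_homRel _ hw).2, rfl, rfl, hw⟩
  -- The representatives are chosen along with the value; saturation and right uniqueness then make
  -- the criterion independent of them.
  choose f hf using key
  refine ⟨f, fun a a' b b' h k => ?_⟩
  obtain ⟨c, c', d, d', h', k', h1, h2, h3⟩ := hf (P.cls h)
  rw [cls_eq_iff] at h1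
  rw [← h2, cls_eq_iff]
  exact ⟨fun h4 => homRel_of_rel _ (P.rel_symm h1) h3 h4, fun h4 =>
    homRel_rightUnique i h3 (homRel_of_rel _ h1 h4 k)⟩

/-- A bijection of quotients that respects the involution `[a, a'] ↦ [a', a]` and the map
`[a, a'] ↦ [a, a]`. -/
def Respects (α : P.Quot ≃ Q.Quot) : Prop :=
  ∀ (a a' : P.Carrier) (b b' : Q.Carrier) (h : (a, a') ∈ P.Dom) (k : (b, b') ∈ Q.Dom),
    α (P.cls h) = Q.cls k →
      α (P.cls (dom_swap h)) = Q.cls (dom_swap k) ∧ α (P.cls (dom_diag h)) = Q.cls (dom_diag k)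

theorem exists_respects_of_iso (i : P ≅ Q) : ∃ α : P.Quot ≃ Q.Quot, Respects α := by
  obtain ⟨f, hf⟩ := exists_quot_map i
  obtain ⟨g, hg⟩ := exists_quot_map i.symm
  refine ⟨⟨f, g, fun x => ?_, fun y => ?_⟩, fun a a' b b' h k hα => ?_⟩
  · obtain ⟨a, a', h, rfl⟩ := exists_cls x
    obtain ⟨b, b', k, hk⟩ := exists_cls (f (P.cls h))
    rw [← hk, hg]
    exact homRel_inv i ((hf _ _ _ _ h k).1 hk.symm)
  · obtain ⟨b, b', k, rfl⟩ := exists_cls y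
    obtain ⟨a, a', h, hh⟩ := exists_cls (g (Q.cls k))
    rw [← hh, hf]
    exact homRel_inv i.symm ((hg _ _ _ _ k h).1 hh.symm)
  · have hR := (isCP_iff _).1 (homRel_isCP i.hom) _ _ _ _ ((hf _ _ _ _ h k).1 hα)
    exact ⟨(hf _ _ _ _ _ _).2 hR.1, (hf _ _ _ _ _ _).2 hR.2⟩

/-- Needed for the candidate inverse morphism to be completely positive as well. -/
theorem Respects.symm {α : P.Quot ≃ Q.Quot} (hα : Respects α) : Respects α.symm := by
  intro b b' a a' k h e
  rw [Equiv.symm_apply_eq] at e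
  simp only [Equiv.symm_apply_eq]
  exact ⟨(hα _ _ _ _ h k e.symm).1.symm, (hα _ _ _ _ h k e.symm).2.symm⟩

/-! ### From bijections of quotients to isomorphisms -/

/-- The relation between the carriers induced by a bijection of quotients. -/
def quotRel (α : P.Quot ≃ Q.Quot) : SetRel (P.Carrier × P.Carrier) (Q.Carrier × Q.Carrier) :=
  {t | ∃ (h : (t.1.1, t.1.2) ∈ P.Dom) (k : (t.2.1, t.2.2) ∈ Q.Dom), α (P.cls h) = Q.cls k}

theorem quotRel_comp_symm (α : P.Quot ≃ Q.Quot) :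
    (quotRel α).comp (quotRel α.symm) = P.rel := by
  ext ⟨⟨a, a'⟩, ⟨c, c'⟩⟩
  constructor
  · rintro ⟨⟨b, b'⟩, ⟨h, k, e⟩, ⟨k', h', e'⟩⟩
    refine (cls_eq_iff h h').1 ?_
    rw [← e', Equiv.eq_symm_apply]
    exact e
  · intro hr
    have h := left_mem_dom hr
    have h' := right_mem_dom hr
    obtain ⟨b, b', k, hk⟩ := exists_cls (α (P.cls h))
    refine ⟨(b, b'), ⟨h, k, hk.symm⟩, ⟨k, h', ?_⟩⟩
    rw [Equiv.symm_apply_eq, hk, (cls_eq_iff h h').2 hr]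

theorem quotRel_absorb (α : P.Quot ≃ Q.Quot) :
    P.rel.comp ((quotRel α).comp Q.rel) = quotRel α := by
  ext ⟨⟨a, a'⟩, ⟨b, b'⟩⟩
  constructor
  · rintro ⟨⟨c, c'⟩, h1, ⟨d, d'⟩, ⟨h, k, e⟩, h2⟩
    refine ⟨left_mem_dom h1, right_mem_dom h2, ?_⟩
    rw [(cls_eq_iff (left_mem_dom h1) h).2 h1, e]
    exact (cls_eq_iff k (right_mem_dom h2)).2 h2
  · rintro ⟨h, k, e⟩
    exact ⟨_, h, _, ⟨h, k, e⟩, k⟩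

/-- The morphism of dagger idempotents induced by a bijection of quotients. -/
def quotHom (α : P.Quot ≃ Q.Quot) (hα : Respects α) : P ⟶ Q :=
  ⟨⟨CPMRel.Hom.mk (quotRel α) ((isCP_iff _).2 fun _ _ _ _ ⟨h, k, e⟩ =>
      ⟨⟨dom_swap h, dom_swap k, (hα _ _ _ _ h k e).1⟩,
        ⟨dom_diag h, dom_diag k, (hα _ _ _ _ h k e).2⟩⟩),
    CPMRel.Hom.ext (quotRel_absorb α)⟩⟩

theorem quotHom_comp_symm (α : P.Quot ≃ Q.Quot) (hα : Respects α) (hα' : Respects α.symm) :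
    quotHom α hα ≫ quotHom α.symm hα' = 𝟙 P :=
  ObjectProperty.hom_ext _ (Karoubi.hom_ext _ _ (CPMRel.Hom.ext (quotRel_comp_symm α)))

theorem nonempty_iso_iff : Nonempty (P ≅ Q) ↔ ∃ α : P.Quot ≃ Q.Quot, Respects α :=
  ⟨fun ⟨i⟩ => exists_respects_of_iso i, fun ⟨α, hα⟩ =>
    ⟨⟨quotHom α hα, quotHom α.symm hα.symm, quotHom_comp_symm α hα hα.symm,
      quotHom_comp_symm α.symm hα.symm hα⟩⟩⟩

end SplitDagger

/-! ### Classes of `F(G)` and the obstruction to the witness -/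

/-- The inclusion `Split_I[CPM[Rel]] ⥤ Split†[CPM[Rel]]`. -/
def unitalInclusion : SplitUnital.{u} ⥤ SplitDagger CPMRel.{u} :=
  ObjectProperty.ιOfLE fun _ h => h.1

theorem mem_rel_canonicalFunctor {G : CPStarRel.{u}} {z w : G.Mor × G.Mor} :
    (z, w) ∈ (unitalInclusion.obj (canonicalFunctor.obj G)).rel ↔
      ∃ e, (z, e) ∈ coaction G ∧ (w, e) ∈ coaction G := by
  change (z, w) ∈ ((coaction G).comp SetRel.id).comp (coaction G).inv ↔ _
  rw [SetRel.comp_id]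
  rfl

theorem mem_dom_canonicalFunctor {G : CPStarRel.{u}} {a b : G.Mor} :
    (a, b) ∈ (unitalInclusion.obj (canonicalFunctor.obj G)).Dom ↔
      ∃ (x y z : G.grpd) (f : x ⟶ z) (g : y ⟶ z), a = ⟨f⟩ ∧ b = ⟨g⟩ := by
  refine mem_rel_canonicalFunctor.trans ?_
  constructor
  · rintro ⟨e, h, -⟩
    obtain ⟨x, y, z, f, g, rfl, rfl, -⟩ := (mem_coaction _ _ _).1 h
    exact ⟨x, y, z, f, g, rfl, rfl⟩
  · rintro ⟨x, y, z, f, g, rfl, rfl⟩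
    have h := (mem_coaction (G := G) _ _ _).2 ⟨_, _, _, f, g, rfl, rfl, rfl⟩
    exact ⟨_, h, h⟩

theorem mem_coaction_self {G : CPStarRel.{u}} {a e : G.Mor} :
    ((a, a), e) ∈ coaction G ↔ e = a.idDom := by
  rw [mem_coaction]
  constructor
  · rintro ⟨x, y, z, f, g, rfl, h, rfl⟩
    cases h
    simp [Mor.idDom]
  · rintro rfl
    obtain ⟨f⟩ := a
    exact ⟨_, _, _, f, f, rfl, rfl, by simp [Mor.idDom]⟩

/-- Since `a⁻¹a` is the identity at `dom a`, diagonal classes are the objects of the groupoid that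
are domains of arrows, that is, all objects. -/
theorem rel_diag_canonicalFunctor {G : CPStarRel.{u}} {a b : G.Mor} :
    ((a, a), (b, b)) ∈ (unitalInclusion.obj (canonicalFunctor.obj G)).rel ↔ a.dom = b.dom := by
  simp only [mem_rel_canonicalFunctor, mem_coaction_self, exists_eq_left]
  obtain ⟨f⟩ := a
  obtain ⟨g⟩ := b
  constructor
  · intro h
    have h' := congrArg (fun m : G.Mor => m.dom) h
    exact h'
  · rintro (rfl : _ = _)
    rfl

theorem witness_rel_iff {z w : ULift.{u} (Fin 3) × ULift.{u} (Fin 3)} :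
    (z, w) ∈ (unitalInclusion.obj witness.{u}).rel ↔
      z = w ∧ (z.1.down, z.2.down) ∈ witnessDom := Iff.rfl

theorem witness_mem_dom_iff {z : ULift.{u} (Fin 3) × ULift.{u} (Fin 3)} :
    z ∈ (unitalInclusion.obj witness.{u}).Dom ↔ (z.1.down, z.2.down) ∈ witnessDom :=
  ⟨fun h => h.2, fun h => ⟨rfl, h⟩⟩

/-- In `F(G)`, a class `[p, p']` and a class `[q, q']` with `[p', p'] = [q, q]` can be composed. -/
theorem exists_composite {G : CPStarRel.{u}} {p p' q q' : G.Mor}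
    (hp : (p, p') ∈ (unitalInclusion.obj (canonicalFunctor.obj G)).Dom)
    (hq : (q, q') ∈ (unitalInclusion.obj (canonicalFunctor.obj G)).Dom)
    (h : ((p', p'), (q, q)) ∈ (unitalInclusion.obj (canonicalFunctor.obj G)).rel) :
    ∃ r : G.Mor, (p, r) ∈ (unitalInclusion.obj (canonicalFunctor.obj G)).Dom ∧
      ((r, r), (q', q')) ∈ (unitalInclusion.obj (canonicalFunctor.obj G)).rel := by
  obtain ⟨x, y, z, f, g, rfl, rfl⟩ := mem_dom_canonicalFunctor.1 hp
  obtain ⟨y', t, w, f', g', rfl, rfl⟩ := mem_dom_canonicalFunctor.1 hq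
  obtain rfl : y = y' := rel_diag_canonicalFunctor.1 h
  -- This is `r = p'q⁻¹q'`, chosen so that `p⁻¹r = (p⁻¹p')(q⁻¹q')`; its domain is that of `q'`.
  exact ⟨⟨g' ≫ Groupoid.inv f' ≫ g⟩, mem_dom_canonicalFunctor.2 ⟨_, _, _, f, _, rfl, rfl⟩,
    rel_diag_canonicalFunctor.2 rfl⟩

theorem isEmpty_canonicalFunctor_iso_witness (G : CPStarRel.{u}) :
    IsEmpty (canonicalFunctor.obj G ≅ witness.{u}) := by
  refine ⟨fun i => ?_⟩
  obtain ⟨α, hα⟩ := SplitDagger.exists_respects_of_iso (unitalInclusion.mapIso i)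
  have h01 : ((⟨0⟩, ⟨1⟩) : ULift.{u} (Fin 3) × ULift.{u} (Fin 3)) ∈
      (unitalInclusion.obj witness.{u}).Dom := witness_mem_dom_iff.2 (by simp [witnessDom])
  have h12 : ((⟨1⟩, ⟨2⟩) : ULift.{u} (Fin 3) × ULift.{u} (Fin 3)) ∈
      (unitalInclusion.obj witness.{u}).Dom := witness_mem_dom_iff.2 (by simp [witnessDom])
  obtain ⟨p, p', hp, ep⟩ := SplitDagger.exists_cls (α.symm (SplitDagger.cls _ h01))
  obtain ⟨q, q', hq, eq⟩ := SplitDagger.exists_cls (α.symm (SplitDagger.cls _ h12))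
  rw [Equiv.eq_symm_apply] at ep eq
  obtain ⟨ep1, ep2⟩ := hα _ _ _ _ _ _ ep
  obtain ⟨eq1, eq2⟩ := hα _ _ _ _ _ _ eq
  -- Swapping before taking the diagonal reaches the second end: `α[p', p'] = [1, 1]`, and likewise
  -- `α[q', q'] = [2, 2]`. As also `α[q, q] = [1, 1]`, the two classes are composable.
  have ep3 := (hα _ _ _ _ _ _ ep1).2
  have eq3 := (hα _ _ _ _ _ _ eq1).2
  obtain ⟨r, hr, hrq⟩ := exists_composite hp hq
    ((SplitDagger.cls_eq_iff _ _).1 (α.injective (ep3.trans eq2.symm)))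
  obtain ⟨b, b', k, hk⟩ := SplitDagger.exists_cls (α (SplitDagger.cls _ hr))
  obtain ⟨er1, er2⟩ := hα _ _ _ _ _ _ hk.symm
  have er3 := (hα _ _ _ _ _ _ er1).2
  rw [(SplitDagger.cls_eq_iff _ (SplitDagger.dom_diag (SplitDagger.dom_swap hq))).2 hrq, eq3]
    at er3
  -- The image `[b, b']` of the composite has ends `[0, 0]` and `[2, 2]`. Classes of the witness are
  -- singletons, so `(b, b') = (0, 2)`.
  have e0 := (witness_rel_iff.1 ((SplitDagger.cls_eq_iff _ _).1 (ep2.symm.trans er2))).1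
  have e2 := (witness_rel_iff.1 ((SplitDagger.cls_eq_iff _ _).1 er3)).1
  have hk' := witness_mem_dom_iff.1 k
  obtain rfl : (⟨0⟩ : ULift.{u} (Fin 3)) = b := congrArg Prod.fst e0
  obtain rfl : (⟨2⟩ : ULift.{u} (Fin 3)) = b' := congrArg Prod.fst e2
  simp [witnessDom] at hk'

theorem mainTheorem3 :
    ¬ canonicalFunctor.{u}.IsEquivalence ∧
    (∀ G : CPStarRel.{u}, IsEmpty (canonicalFunctor.obj G ≅ witness.{u})) ∧
    (∀ P Q : SplitDagger CPMRel.{u}, Nonempty (P ≅ Q) ↔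
      ∃ α : SplitDagger.Quot P ≃ SplitDagger.Quot Q,
        ∀ (a a' : SplitDagger.Carrier P) (b b' : SplitDagger.Carrier Q)
          (h : (a, a') ∈ SplitDagger.Dom P) (k : (b, b') ∈ SplitDagger.Dom Q),
          α (SplitDagger.cls P h) = SplitDagger.cls Q k →
            α (SplitDagger.cls P (SplitDagger.dom_swap h)) =
                SplitDagger.cls Q (SplitDagger.dom_swap k) ∧
              α (SplitDagger.cls P (SplitDagger.dom_diag h)) =
                SplitDagger.cls Q (SplitDagger.dom_diag k)) := by
  refine ⟨fun _ => ?_, isEmpty_canonicalFunctor_iso_witness,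
    fun P Q => SplitDagger.nonempty_iso_iff⟩
  exact (isEmpty_canonicalFunctor_iso_witness _).false (canonicalFunctor.objObjPreimageIso witness)
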